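/- Define the Fibonacci polynomials in $\mathbb{Z}[x]$ by $F_1(x)=1$, $F_2(x)=x$ and $F_n(x)=xF_{n-1}(x)+F_{n-2}(x)$ for $n\ge 3$. For $n\ge 2$ let the $n$-th fibotomic polynomial $\Psi_n(x)$ be the product of the (distinct) monic irreducible factors of $F_n(x)$ in $\mathbb{Z}[x]$ that are not factors of $F_k(x)$ for any $1\le k<n$. Let $\Delta(f)$ denote the discriminant of a polynomial $f$ and $\varphi$ Euler's totient function. Then for every integer $n\ge 2$, $$\Delta(\Psi_n(x))=\begin{cases}\dfrac{(-1)^{\lfloor\varphi(n)/2\rfloor}(2n)^{\varphi(n)}}{p^{p^{\alpha-1}+1}}&\text{if }n=p^\alpha\text{ for some prime }p\text{ and some positive integer }\alpha,\\[2ex]\dfrac{(-1)^{\varphi(n)/2}(2n)^{\varphi(n)}}{\prod_{p\mid n}p^{\varphi(n)/(p-1)}}&\text{otherwise,}\end{cases}$$ where the product in the second case runs over the primes $p$ dividing $n$. -/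

import Mathlib

open Polynomial

/-- The Fibonacci polynomials in `ℤ[X]`: `F₁ = 1`, `F₂ = X`, `Fₙ = X * Fₙ₋₁ + Fₙ₋₂` for `n ≥ 3`,
with the usual extension `F₀ = 0`. -/
noncomputable def fibPoly : ℕ → ℤ[X]
  | 0 => 0
  | 1 => 1
  | n + 2 => X * fibPoly (n + 1) + fibPoly n

/-- The monic irreducible factors in `ℤ[X]` of `Fₙ` that divide no `Fₖ` with `1 ≤ k < n`. -/
def fibotomicFactors (n : ℕ) : Set ℤ[X] :=
  {q | q.Monic ∧ Irreducible q ∧ q ∣ fibPoly n ∧ ∀ k : ℕ, 1 ≤ k → k < n → ¬ q ∣ fibPoly k}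

/-- The `n`-th fibotomic polynomial `Ψₙ`, `n ≥ 1`: the product of the monic irreducible factors of
`Fₙ` that divide no `Fₖ` with `1 ≤ k < n`. The product is over a finite set for `n ≥ 1`
(see `fibotomicFactors_finite`), and it is the empty product `1` for `n = 1`. -/
noncomputable def fibotomic (n : ℕ) : ℤ[X] :=
  ∏ᶠ q ∈ fibotomicFactors n, q

theorem fibPoly_monic_natDegree (n : ℕ) :
    (fibPoly (n + 1)).Monic ∧ (fibPoly (n + 1)).natDegree = n := by
  induction n using Nat.strong_induction_on with
  | _ n ih =>
    match n with
    | 0 => simp [fibPoly]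
    | 1 => simp [fibPoly, monic_X]
    | m + 2 =>
      obtain ⟨h1, d1⟩ := ih (m + 1) (by omega)
      obtain ⟨h0, d0⟩ := ih m (by omega)
      have hm : (X * fibPoly (m + 1 + 1)).Monic := monic_X.mul h1
      have hd : (X * fibPoly (m + 1 + 1)).natDegree = m + 2 := by
        rw [monic_X.natDegree_mul h1, natDegree_X, d1]; omega
      have hlt : (fibPoly (m + 1)).degree < (X * fibPoly (m + 1 + 1)).degree := by
        apply degree_lt_degree
        omega
      have e : fibPoly (m + 2 + 1) = X * fibPoly (m + 1 + 1) + fibPoly (m + 1) := by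
        rw [fibPoly]
      rw [e]
      exact ⟨hm.add_of_left hlt, by rw [natDegree_add_eq_left_of_degree_lt hlt, hd]⟩

theorem fibotomicFactors_finite (n : ℕ) (hn : 1 ≤ n) : (fibotomicFactors n).Finite := by
  classical
  obtain ⟨m, rfl⟩ : ∃ m, n = m + 1 := ⟨n - 1, by omega⟩
  have h0 : fibPoly (m + 1) ≠ 0 := (fibPoly_monic_natDegree m).1.ne_zero
  refine (UniqueFactorizationMonoid.normalizedFactors
    (fibPoly (m + 1))).toFinset.finite_toSet.subset ?_
  rintro q ⟨hq, hi, hd, -⟩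
  obtain ⟨r, hr, hqr⟩ := UniqueFactorizationMonoid.exists_mem_normalizedFactors_of_dvd h0 hi hd
  have h1 : normalize q = q := hq.normalize_eq_self
  have h2 := UniqueFactorizationMonoid.normalize_normalized_factor r hr
  have h3 : q = r := by rw [← h1, ← h2]; exact normalize_eq_normalize_iff_associated.2 hqr
  rw [h3]
  exact Multiset.mem_toFinset.2 hr

/-! Substituting x = z - z⁻¹ gives the Binet formula (z + z⁻¹) Fₙ(x) = zⁿ - (-z⁻¹)ⁿ, so the roots of
Fₙ are 2i cos(πk/n), 0 < k < n, and those of Ψₙ are the ones with k prime to n. With ζ = -z², this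
becomes (-z)^φ(n) Ψₙ(z - z⁻¹) = Φₙ(ζ) (`aeval_fibotomic_sub_inv`). Differentiating at the roots and
multiplying (`prod_aeval_derivative_fibotomic`) yields disc(Ψₙ) · Φₙ(1) = 2^φ(n) · disc ℚ(ζₙ). The
known cyclotomic discriminant and the value Φₙ(1), which is p for powers of p and 1 otherwise,
finish the proof. -/

/-- The point `i e^{iπt}` of the unit circle. -/
noncomputable def fibArg (t : ℝ) : ℂ :=
  Complex.I * Complex.exp (Real.pi * t * Complex.I)

/-- The purely imaginary number `2i cos (πt)`. -/
noncomputable def fibRoot (t : ℝ) : ℂ :=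
  2 * Complex.I * (Real.cos (Real.pi * t) : ℝ)

theorem fibArg_ne_zero (t : ℝ) : fibArg t ≠ 0 := by simp [fibArg]

theorem inv_fibArg (t : ℝ) :
    (fibArg t)⁻¹ = -(Complex.I * Complex.exp (-(Real.pi * t * Complex.I))) := by
  rw [fibArg, mul_inv, Complex.inv_I, Complex.exp_neg]
  ring

theorem fibArg_sub_inv (t : ℝ) : fibArg t - (fibArg t)⁻¹ = fibRoot t := by
  rw [inv_fibArg, fibArg, fibRoot, Complex.ofReal_cos, Complex.cos]
  push_cast
  ring_nf

theorem fibArg_add_inv (t : ℝ) :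
    fibArg t + (fibArg t)⁻¹ = -2 * (Real.sin (Real.pi * t) : ℝ) := by
  rw [inv_fibArg, fibArg, Complex.ofReal_sin, Complex.sin]
  push_cast
  ring_nf

theorem neg_fibArg_sq (t : ℝ) : -fibArg t ^ 2 = Complex.exp (2 * Real.pi * t * Complex.I) := by
  rw [fibArg, mul_pow, Complex.I_sq, ← Complex.exp_nat_mul]
  push_cast
  ring_nf

theorem neg_fibArg_sq_div {n : ℕ} (k : ℕ) :
    -fibArg (k / n) ^ 2 = Complex.exp (2 * Real.pi * Complex.I / n) ^ k := by
  rw [neg_fibArg_sq, ← Complex.exp_nat_mul]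
  push_cast
  ring_nf

theorem fibArg_one_sub (t : ℝ) : fibArg (1 - t) = (fibArg t)⁻¹ := by
  rw [inv_fibArg, fibArg]
  have : (Real.pi * ((1 - t : ℝ) : ℂ) * Complex.I : ℂ)
      = Real.pi * Complex.I + -(Real.pi * t * Complex.I) := by push_cast; ring
  rw [this, Complex.exp_add, Complex.exp_pi_mul_I]
  ring

theorem fibRoot_injOn : Set.InjOn fibRoot (Set.Icc 0 1) := by
  intro s hs t ht h
  have h1 : Real.cos (Real.pi * s) = Real.cos (Real.pi * t) := by
    simpa only [fibRoot, mul_right_inj' (mul_ne_zero two_ne_zero Complex.I_ne_zero),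
      Complex.ofReal_inj] using h
  have hpi := Real.pi_pos
  have h2 := Real.injOn_cos ⟨by have := hs.1; positivity, by nlinarith [hs.2]⟩
    ⟨by have := ht.1; positivity, by nlinarith [ht.2]⟩ h1
  exact mul_left_cancel₀ hpi.ne' h2

theorem fibRoot_div_injOn (n : ℕ) :
    Set.InjOn (fun k : ℕ => fibRoot (k / n)) (Finset.range n) := by
  intro j hj k hk h
  have hj := Finset.mem_range.1 (Finset.mem_coe.1 hj)
  have hpos : (0 : ℝ) < n := by exact_mod_cast (by omega : 0 < n)
  have key : ∀ l < n, (l : ℝ) / n ∈ Set.Icc (0 : ℝ) 1 := fun l hl =>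
    ⟨by positivity, (div_le_one hpos).2 (by exact_mod_cast hl.le)⟩
  have := fibRoot_injOn (key j hj) (key k (Finset.mem_range.1 (Finset.mem_coe.1 hk))) h
  rw [div_left_inj' hpos.ne'] at this
  exact_mod_cast this

/-! ### Roots of the Fibonacci polynomials -/

/-- For x = z - z⁻¹, the roots of T² - xT - 1 are z and -z⁻¹, with difference z + z⁻¹. -/
theorem aeval_fibPoly_sub_inv {z : ℂ} (hz : z ≠ 0) (n : ℕ) :
    (z + z⁻¹) * aeval (z - z⁻¹) (fibPoly n) = z ^ n - (-z⁻¹) ^ n := by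
  induction n using Nat.strong_induction_on with
  | _ n ih =>
    match n with
    | 0 => simp [fibPoly]
    | 1 => simp [fibPoly]
    | m + 2 =>
      have h1 := ih (m + 1) (by omega)
      have h0 := ih m (by omega)
      rw [fibPoly, map_add, map_mul, aeval_X]
      have hw : z * z⁻¹ = 1 := mul_inv_cancel₀ hz
      generalize z⁻¹ = w at *
      linear_combination (z - w) * h1 + h0 + (-z ^ m + (-w) ^ m) * hw

theorem aeval_fibRoot_fibPoly {k n : ℕ} (hk : 1 ≤ k) (hkn : k < n) :
    aeval (fibRoot (k / n)) (fibPoly n) = 0 := by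
  have hn : (0 : ℝ) < n := by exact_mod_cast (by omega : 0 < n)
  have hk' : (0 : ℝ) < k := by exact_mod_cast hk
  have hkn' : (k : ℝ) < n := by exact_mod_cast hkn
  have hz := fibArg_ne_zero (k / n)
  have h := aeval_fibPoly_sub_inv hz n
  rw [fibArg_sub_inv, fibArg_add_inv] at h
  have hs : Real.sin (Real.pi * (k / n)) ≠ 0 := by
    refine (Real.sin_pos_of_pos_of_lt_pi (by positivity) ?_).ne'
    have : (k : ℝ) / n < 1 := (div_lt_one hn).2 hkn'
    nlinarith [Real.pi_pos]
  have h1 : (-fibArg (k / n) ^ 2) ^ n = 1 := by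
    rw [neg_fibArg_sq_div, ← pow_mul, mul_comm k, pow_mul,
      (Complex.isPrimitiveRoot_exp n (by omega)).pow_eq_one, one_pow]
  have h2 : fibArg (k / n) ^ n = (-(fibArg (k / n))⁻¹) ^ n := by
    have : (-(fibArg (k / n))⁻¹) ^ n * (-fibArg (k / n) ^ 2) ^ n = fibArg (k / n) ^ n := by
      rw [← mul_pow]
      congr 1
      field_simp
    rw [← this, h1, mul_one]
  rw [h2, sub_self] at h
  refine (mul_eq_zero.1 h).resolve_left ?_
  exact mul_ne_zero (by norm_num) (Complex.ofReal_ne_zero.2 hs)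

/-- Over `ℂ`, the roots of `Fₙ` are the numbers `2i cos (πk/n)` with `1 ≤ k < n`. -/
theorem roots_map_fibPoly {n : ℕ} (hn : 1 ≤ n) :
    ((fibPoly n).map (algebraMap ℤ ℂ)).roots =
      ((Finset.Ico 1 n).image fun k : ℕ => fibRoot (k / n)).val := by
  obtain ⟨m, rfl⟩ : ∃ m, n = m + 1 := ⟨n - 1, by omega⟩
  obtain ⟨hm, hd⟩ := fibPoly_monic_natDegree m
  have h0 : (fibPoly (m + 1)).map (algebraMap ℤ ℂ) ≠ 0 := (hm.map _).ne_zero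
  symm
  refine Multiset.eq_of_le_of_card_le ?_ ?_
  · refine (Multiset.le_iff_subset (Finset.nodup _)).2 fun x hx => ?_
    obtain ⟨k, hk, rfl⟩ := Finset.mem_image.1 (Finset.mem_def.2 hx)
    obtain ⟨hk1, hk2⟩ := Finset.mem_Ico.1 hk
    rw [mem_roots h0, IsRoot, eval_map_algebraMap]
    exact aeval_fibRoot_fibPoly hk1 hk2
  -- The n - 1 distinct roots already found exhaust the degree.
  · refine (card_roots' _).trans ?_
    rw [hm.natDegree_map, hd, Finset.card_val, Finset.card_image_of_injOn]
    · simp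
    · exact (fibRoot_div_injOn _).mono fun k hk => by simp at hk ⊢; omega

theorem aeval_fibPoly_eq_zero_iff {n : ℕ} (hn : 1 ≤ n) (x : ℂ) :
    aeval x (fibPoly n) = 0 ↔ ∃ k : ℕ, 1 ≤ k ∧ k < n ∧ fibRoot (k / n) = x := by
  have h0 : (fibPoly n).map (algebraMap ℤ ℂ) ≠ 0 := by
    obtain ⟨m, rfl⟩ : ∃ m, n = m + 1 := ⟨n - 1, by omega⟩
    exact ((fibPoly_monic_natDegree m).1.map _).ne_zero
  rw [← eval_map_algebraMap, ← IsRoot, ← mem_roots h0, roots_map_fibPoly hn]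
  simp [and_assoc]

/-- Among the roots `2i cos (πk/n)` of `Fₙ`, those with `k` prime to `n` are the ones that are not
roots of some earlier `Fₘ`. -/
theorem exists_aeval_fibRoot_fibPoly_eq_zero_iff {k n : ℕ} (hk : 1 ≤ k) (hkn : k < n) :
    (∃ m, 1 ≤ m ∧ m < n ∧ aeval (fibRoot (k / n)) (fibPoly m) = 0) ↔ ¬ n.Coprime k := by
  have hn : (0 : ℝ) < n := by exact_mod_cast (by omega : 0 < n)
  constructor
  · rintro ⟨m, hm, hmn, h⟩ hc
    obtain ⟨j, hj, hjm, h⟩ := (aeval_fibPoly_eq_zero_iff hm _).1 h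
    have hm' : (0 : ℝ) < m := by exact_mod_cast hm
    have := fibRoot_injOn ⟨by positivity, (div_le_one hm').2 (by exact_mod_cast hjm.le)⟩
      ⟨by positivity, (div_le_one hn).2 (by exact_mod_cast hkn.le)⟩ h
    rw [div_eq_div_iff hm'.ne' hn.ne'] at this
    have h' : j * n = k * m := by exact_mod_cast this
    have hd : n ∣ m := hc.dvd_of_dvd_mul_left ⟨j, by rw [← h', mul_comm]⟩
    exact absurd (Nat.le_of_dvd hm hd) (by omega)
  · intro hc
    obtain ⟨g, hg⟩ : ∃ g, g = n.gcd k := ⟨_, rfl⟩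
    have hg0 : 0 < g := hg ▸ Nat.gcd_pos_of_pos_right _ hk
    have hg1 : g ≠ 1 := fun h => hc (by rw [Nat.Coprime, ← hg, h])
    obtain ⟨m, rfl⟩ : g ∣ n := hg ▸ Nat.gcd_dvd_left n k
    obtain ⟨j, rfl⟩ : g ∣ k := hg ▸ Nat.gcd_dvd_right _ k
    have hj : 1 ≤ j := Nat.pos_of_ne_zero (by rintro rfl; simp at hk)
    have hjm : j < m := lt_of_mul_lt_mul_left hkn hg0.le
    refine ⟨m, by omega, by nlinarith [show 2 ≤ g by omega], ?_⟩
    have : ((g * j : ℕ) : ℝ) / (g * m : ℕ) = j / m := by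
      push_cast
      exact mul_div_mul_left _ _ (by exact_mod_cast hg0.ne')
    rw [this]
    exact aeval_fibRoot_fibPoly hj hjm

/-! ### Roots of the fibotomic polynomials -/

/-- ℤ is integrally closed, so `q` is associated to the minimal polynomial of `x` over ℤ. -/
theorem dvd_of_irreducible_of_aeval_eq_zero {q f : ℤ[X]} (hq : Irreducible q) (hm : q.Monic)
    {x : ℂ} (hx : aeval x q = 0) (hf : aeval x f = 0) : q ∣ f := by
  have hi : IsIntegral ℤ x := ⟨q, hm, by rwa [← aeval_def]⟩
  have h1 := minpoly.isIntegrallyClosed_dvd hi hx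
  have h2 : Associated (minpoly ℤ x) q := (minpoly.irreducible hi).associated_of_dvd hq h1
  exact h2.symm.dvd.trans (minpoly.isIntegrallyClosed_dvd hi hf)

theorem fibotomic_monic (n : ℕ) : (fibotomic n).Monic :=
  finprod_mem_induction Monic monic_one (fun _ _ => Monic.mul) fun _ hq => hq.1

theorem fibotomic_eq_prod {n : ℕ} (hn : 1 ≤ n) :
    fibotomic n = ∏ q ∈ (fibotomicFactors_finite n hn).toFinset, q :=
  finprod_mem_eq_finite_toFinset_prod _ _

theorem fibotomic_dvd_fibPoly {n : ℕ} (hn : 1 ≤ n) : fibotomic n ∣ fibPoly n := by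
  rw [fibotomic_eq_prod hn]
  refine Finset.prod_dvd_of_isRelPrime ?_ fun q hq => ((Set.Finite.mem_toFinset _).1 hq).2.2.1
  intro q hq r hr hqr
  have hq' := (Set.Finite.mem_toFinset _).1 (Finset.mem_coe.1 hq)
  have hr' := (Set.Finite.mem_toFinset _).1 (Finset.mem_coe.1 hr)
  refine (hq'.2.1.isRelPrime_iff_not_dvd).2 fun h => hqr ?_
  exact eq_of_monic_of_associated hq'.1 hr'.1 (hq'.2.1.associated_of_dvd hr'.2.1 h)

theorem aeval_fibotomic_eq_zero_iff {n : ℕ} (hn : 2 ≤ n) (x : ℂ) :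
    aeval x (fibotomic n) = 0 ↔ ∃ k ∈ (Finset.range n).filter n.Coprime, fibRoot (k / n) = x := by
  have hn1 : 1 ≤ n := by omega
  rw [fibotomic_eq_prod hn1, map_prod, Finset.prod_eq_zero_iff]
  simp only [Set.Finite.mem_toFinset]
  constructor
  · rintro ⟨q, ⟨hm, hi, hd, hnd⟩, hx⟩
    obtain ⟨k, hk, hkn, rfl⟩ := (aeval_fibPoly_eq_zero_iff hn1 x).1
      (aeval_eq_zero_of_dvd_aeval_eq_zero hd hx)
    refine ⟨k, Finset.mem_filter.2 ⟨Finset.mem_range.2 hkn, ?_⟩, rfl⟩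
    by_contra hc
    obtain ⟨m, hm1, hmn, h⟩ := (exists_aeval_fibRoot_fibPoly_eq_zero_iff hk hkn).2 hc
    exact hnd m hm1 hmn (dvd_of_irreducible_of_aeval_eq_zero hi hm hx h)
  · rintro ⟨k, hk, rfl⟩
    obtain ⟨hkn, hc⟩ := Finset.mem_filter.1 hk
    have hkn := Finset.mem_range.1 hkn
    have hk1 : 1 ≤ k := Nat.pos_of_ne_zero (by rintro rfl; simp at hc; omega)
    have h0 := aeval_fibRoot_fibPoly hk1 hkn
    have hi : IsIntegral ℤ (fibRoot (k / n)) := by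
      obtain ⟨m, rfl⟩ : ∃ m, n = m + 1 := ⟨n - 1, by omega⟩
      exact ⟨_, (fibPoly_monic_natDegree m).1, by rwa [← aeval_def]⟩
    refine ⟨minpoly ℤ (fibRoot (k / n)), ⟨minpoly.monic hi, minpoly.irreducible hi,
      minpoly.isIntegrallyClosed_dvd hi h0, fun m hm hmn hd => ?_⟩, minpoly.aeval _ _⟩
    exact (exists_aeval_fibRoot_fibPoly_eq_zero_iff hk1 hkn).1
      ⟨m, hm, hmn, aeval_eq_zero_of_dvd_aeval_eq_zero hd (minpoly.aeval _ _)⟩ hc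

theorem roots_map_fibotomic {n : ℕ} (hn : 2 ≤ n) :
    ((fibotomic n).map (algebraMap ℤ ℂ)).roots =
      ((Finset.range n).filter n.Coprime).val.map fun k : ℕ => fibRoot (k / n) := by
  have hn1 : 1 ≤ n := by omega
  have h0 : (fibPoly n).map (algebraMap ℤ ℂ) ≠ 0 := by
    obtain ⟨m, rfl⟩ : ∃ m, n = m + 1 := ⟨n - 1, by omega⟩
    exact ((fibPoly_monic_natDegree m).1.map _).ne_zero
  have hle := roots.le_of_dvd h0 (map_dvd (algebraMap ℤ ℂ) (fibotomic_dvd_fibPoly hn1))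
  -- The roots are simple because those of Fₙ are.
  have hnd := Multiset.nodup_of_le hle (by rw [roots_map_fibPoly hn1]; exact Finset.nodup _)
  have hinj : Set.InjOn (fun k : ℕ => fibRoot (k / n)) ((Finset.range n).filter n.Coprime) :=
    (fibRoot_div_injOn n).mono (Finset.coe_subset.2 (Finset.filter_subset _ _))
  rw [← Finset.image_val_of_injOn hinj]
  refine (Multiset.Nodup.ext hnd (Finset.nodup _)).2 fun x => ?_
  rw [mem_roots ((fibotomic_monic n).map _).ne_zero, IsRoot, eval_map_algebraMap,
    aeval_fibotomic_eq_zero_iff hn]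
  simp

/-- Over `ℂ`, the fibotomic polynomial is the product of the `X - 2i cos (πk/n)` over the residues
`k` prime to `n`. -/
theorem map_fibotomic {n : ℕ} (hn : 2 ≤ n) :
    (fibotomic n).map (algebraMap ℤ ℂ) =
      ∏ k ∈ (Finset.range n).filter n.Coprime, (X - C (fibRoot (k / n))) := by
  rw [(IsAlgClosed.splits _).eq_prod_roots_of_monic ((fibotomic_monic n).map _),
    roots_map_fibotomic hn, Multiset.map_map]
  rfl

theorem natDegree_fibotomic {n : ℕ} (hn : 2 ≤ n) : (fibotomic n).natDegree = n.totient := by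
  rw [← (fibotomic_monic n).natDegree_map (algebraMap ℤ ℂ),
    (IsAlgClosed.splits _).natDegree_eq_card_roots, roots_map_fibotomic hn, Multiset.card_map]
  rfl

/-! ### Discriminant as a product of derivative values -/

theorem Polynomial.discr_eq_prod_eval_derivative {R S : Type*} [CommRing R] [CommRing S] [IsDomain S]
    (φ : R →+* S) {f : R[X]} (hf : f.Monic) (hd : 0 < f.natDegree) (hs : (f.map φ).Splits) :
    φ f.discr = (-1) ^ (f.natDegree * (f.natDegree - 1) / 2) *
      ((f.map φ).roots.map (f.map φ).derivative.eval).prod := by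
  have h1 := congrArg φ (resultant_deriv (natDegree_pos_iff_degree_pos.1 hd))
  -- The formal degree of f' is fixed at deg f - 1, since its true degree may drop in positive
  -- characteristic.
  have h2 := resultant_eq_prod_eval (f.map φ) (f.map φ).derivative (f.natDegree - 1)
    ((natDegree_derivative_le _).trans (by rw [hf.natDegree_map])) hs
  rw [(hf.map φ).leadingCoeff, one_pow, one_mul, hf.natDegree_map, derivative_map,
    resultant_map_map] at h2
  rw [h2, hf.leadingCoeff, mul_one, map_mul, map_pow, map_neg, map_one] at h1
  rw [derivative_map, h1, ← mul_assoc, ← mul_pow, neg_one_mul, neg_neg, one_pow, one_mul]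

theorem discr_fibotomic {n : ℕ} (hn : 2 ≤ n) :
    ((fibotomic n).discr : ℂ) = (-1) ^ (n.totient * (n.totient - 1) / 2) *
      ∏ k ∈ (Finset.range n).filter n.Coprime,
        aeval (fibRoot (k / n)) (fibotomic n).derivative := by
  have h := discr_eq_prod_eval_derivative (algebraMap ℤ ℂ) (fibotomic_monic n)
    (by rw [natDegree_fibotomic hn]; exact Nat.totient_pos.2 (by omega)) (IsAlgClosed.splits _)
  rw [natDegree_fibotomic hn, roots_map_fibotomic hn, Multiset.map_map] at h
  refine h.trans ?_
  simp only [Function.comp_def, derivative_map, eval_map_algebraMap]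
  rfl

/-! ### Comparison with the cyclotomic polynomial -/

theorem prod_coprime_reflect {M : Type*} [CommMonoid M] {n : ℕ} (hn : 2 ≤ n) (f : ℕ → M) :
    ∏ k ∈ (Finset.range n).filter n.Coprime, f (n - k) =
      ∏ k ∈ (Finset.range n).filter n.Coprime, f k := by
  have key : ∀ k ∈ (Finset.range n).filter n.Coprime, 1 ≤ k ∧ k < n ∧
      n - k ∈ (Finset.range n).filter n.Coprime := by
    intro k hk
    obtain ⟨hkn, hc⟩ := Finset.mem_filter.1 hk
    have hkn := Finset.mem_range.1 hkn
    have hk1 : 1 ≤ k := Nat.pos_of_ne_zero (by rintro rfl; simp at hc; omega)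
    refine ⟨hk1, hkn, Finset.mem_filter.2 ⟨Finset.mem_range.2 (by omega), ?_⟩⟩
    exact (Nat.coprime_self_sub_right hkn.le).2 hc
  refine Finset.prod_nbij' (n - ·) (n - ·) (fun k hk => (key k hk).2.2)
    (fun k hk => (key k hk).2.2) (fun k hk => ?_) (fun k hk => ?_) fun k hk => rfl
  all_goals have := key k hk; omega

theorem prod_coprime_pow {M : Type*} [CommMonoid M] {n : ℕ} (hn : 1 ≤ n) (f : ℂ → M) :
    ∏ k ∈ (Finset.range n).filter n.Coprime, f (Complex.exp (2 * Real.pi * Complex.I / n) ^ k) =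
      ∏ ζ ∈ primitiveRoots n ℂ, f ζ := by
  have hζ := Complex.isPrimitiveRoot_exp n (by omega)
  refine Finset.prod_bij (fun k _ => Complex.exp (2 * Real.pi * Complex.I / n) ^ k) ?_ ?_ ?_ ?_
  · intro k hk
    exact (mem_primitiveRoots hn).2 (hζ.pow_of_coprime k (Finset.mem_filter.1 hk).2.symm)
  · intro j hj k hk h
    exact hζ.pow_inj (Finset.mem_range.1 (Finset.mem_filter.1 hj).1)
      (Finset.mem_range.1 (Finset.mem_filter.1 hk).1) h
  · intro x hx
    have : NeZero n := ⟨by omega⟩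
    obtain ⟨k, hk, hc, rfl⟩ := hζ.isPrimitiveRoot_iff.1 ((mem_primitiveRoots hn).1 hx)
    exact ⟨k, Finset.mem_filter.2 ⟨Finset.mem_range.2 hk, hc.symm⟩, rfl⟩
  · intro k hk
    rfl

theorem fibArg_reflect {n k : ℕ} (hn : 1 ≤ n) (hk : k ≤ n) :
    fibArg ((n - k : ℕ) / n) = (fibArg (k / n))⁻¹ := by
  have hn' : (n : ℝ) ≠ 0 := by exact_mod_cast (by omega : n ≠ 0)
  rw [← fibArg_one_sub, Nat.cast_sub hk]
  congr 1
  field_simp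

theorem cyclotomic_eval_eq_prod {n : ℕ} (hn : 1 ≤ n) (x : ℂ) :
    eval x (cyclotomic n ℂ) = ∏ ζ ∈ primitiveRoots n ℂ, (x - ζ) := by
  rw [cyclotomic_eq_prod_X_sub_primitiveRoots (Complex.isPrimitiveRoot_exp n (by omega)),
    eval_prod]
  simp

/-- The substitution `x = z - z⁻¹` turns the fibotomic polynomial into a cyclotomic one. -/
theorem aeval_fibotomic_sub_inv {n : ℕ} (hn : 2 ≤ n) {z : ℂ} (hz : z ≠ 0) :
    (-z) ^ n.totient * aeval (z - z⁻¹) (fibotomic n) = eval (-z ^ 2) (cyclotomic n ℂ) := by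
  rw [← eval_map_algebraMap, map_fibotomic hn, eval_prod, cyclotomic_eval_eq_prod (by omega),
    ← prod_coprime_pow (by omega)]
  simp only [eval_sub, eval_X, eval_C]
  -- With a = `fibArg (k / n)`, the factor is -(z - a)(z + a⁻¹), and a⁻¹ belongs to n - k.
  -- Reindexing the second factors by k ↦ n - k leaves -(z - a)(z + a) = -z² - (-a²).
  have h1 : ∀ k ∈ (Finset.range n).filter n.Coprime, -z * (z - z⁻¹ - fibRoot (k / n)) =
      -(z - fibArg (k / n)) * (z + fibArg ((n - k : ℕ) / n)) := by
    intro k hk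
    rw [fibArg_reflect (by omega) (Finset.mem_range.1 (Finset.mem_filter.1 hk).1).le,
      ← fibArg_sub_inv]
    have := fibArg_ne_zero (k / n)
    field_simp
    ring
  rw [Nat.totient, ← Finset.prod_const, ← Finset.prod_mul_distrib, Finset.prod_congr rfl h1,
    Finset.prod_mul_distrib, prod_coprime_reflect hn fun k : ℕ => z + fibArg (k / n),
    ← Finset.prod_mul_distrib]
  refine Finset.prod_congr rfl fun k _ => ?_
  rw [← neg_fibArg_sq_div]
  ring

/-- Differentiate the substitution identity at z = `fibArg (k / n)` and multiply by z², using z² + 1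
= 1 - ζ. The derivative of (-z)^φ(n) does not contribute, as Ψₙ vanishes there. -/
theorem aeval_derivative_fibotomic {n k : ℕ} (hn : 2 ≤ n)
    (hk : k ∈ (Finset.range n).filter n.Coprime) :
    (-fibArg (k / n)) ^ n.totient * aeval (fibRoot (k / n)) (fibotomic n).derivative *
      (1 - Complex.exp (2 * Real.pi * Complex.I / n) ^ k) =
    2 * (-fibArg (k / n)) ^ 3 *
      eval (Complex.exp (2 * Real.pi * Complex.I / n) ^ k) (derivative (cyclotomic n ℂ)) := by
  set z := fibArg (k / n) with hzdef
  have hz : z ≠ 0 := fibArg_ne_zero _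
  have hL : HasDerivAt (fun w : ℂ => (-w) ^ n.totient * aeval (w - w⁻¹) (fibotomic n))
      ((-z) ^ n.totient * (aeval (z - z⁻¹) (fibotomic n).derivative * (1 - -(z ^ 2)⁻¹))) z := by
    have h1 : HasDerivAt (fun w : ℂ => w - w⁻¹) (1 - -(z ^ 2)⁻¹) z :=
      (hasDerivAt_id z).sub (hasDerivAt_inv hz)
    have h2 : HasDerivAt (fun w : ℂ => aeval (w - w⁻¹) (fibotomic n))
        (aeval (z - z⁻¹) (fibotomic n).derivative * (1 - -(z ^ 2)⁻¹)) z :=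
      HasDerivAt.comp z (h₂ := fun x : ℂ => aeval x (fibotomic n))
        ((fibotomic n).hasDerivAt_aeval (z - z⁻¹)) h1
    have h3 : HasDerivAt (fun w : ℂ => (-w) ^ n.totient)
        (n.totient * (-z) ^ (n.totient - 1) * -1) z := (hasDerivAt_neg z).pow _
    have h0 : aeval (z - z⁻¹) (fibotomic n) = 0 := by
      rw [fibArg_sub_inv]
      exact (aeval_fibotomic_eq_zero_iff hn _).2 ⟨k, hk, rfl⟩
    have := h3.mul h2
    rwa [h0, mul_zero, zero_add] at this
  have hR : HasDerivAt (fun w : ℂ => eval (-w ^ 2) (cyclotomic n ℂ))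
      (eval (-z ^ 2) (derivative (cyclotomic n ℂ)) * (-(2 * z))) z := by
    have h1 : HasDerivAt (fun w : ℂ => -w ^ 2) (-(2 * z)) z := by
      simpa using (hasDerivAt_pow 2 z).fun_neg
    exact ((cyclotomic n ℂ).hasDerivAt (-z ^ 2)).comp z h1
  have heq : (fun w : ℂ => (-w) ^ n.totient * aeval (w - w⁻¹) (fibotomic n)) =ᶠ[nhds z]
      fun w : ℂ => eval (-w ^ 2) (cyclotomic n ℂ) :=
    (eventually_ne_nhds hz).mono fun w hw => aeval_fibotomic_sub_inv hn hw
  have h := (hL.congr_of_eventuallyEq heq.symm).unique hR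
  rw [← neg_fibArg_sq_div, ← fibArg_sub_inv, ← hzdef]
  have hz2 : z ^ 2 * (z ^ 2)⁻¹ = 1 := mul_inv_cancel₀ (pow_ne_zero 2 hz)
  linear_combination z ^ 2 * h - (-z) ^ n.totient *
    aeval (z - z⁻¹) (fibotomic n).derivative * hz2

theorem prod_fibArg {n : ℕ} (hn : 2 ≤ n) :
    ∏ k ∈ (Finset.range n).filter n.Coprime, fibArg (k / n) = (-1) ^ n.totient := by
  have hn' : (n : ℝ) ≠ 0 := by exact_mod_cast (by omega : n ≠ 0)
  have hsum : ∑ k ∈ (Finset.range n).filter n.Coprime, (k / n : ℝ) = n.totient / 2 := by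
    -- `Multiplicative` turns the reflection of products into one of sums: pairing k with n - k
    -- gives average 1/2.
    have h := prod_coprime_reflect hn fun k : ℕ => Multiplicative.ofAdd (k / n : ℝ)
    rw [← ofAdd_sum, ← ofAdd_sum] at h
    have h := Multiplicative.ofAdd.injective h
    have h1 : ∀ k ∈ (Finset.range n).filter n.Coprime, ((n - k : ℕ) / n : ℝ) = 1 - k / n := by
      intro k hk
      rw [Nat.cast_sub (Finset.mem_range.1 (Finset.mem_filter.1 hk).1).le]
      field_simp
    rw [Finset.sum_congr rfl h1, Finset.sum_sub_distrib] at h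
    simp only [Finset.sum_const, nsmul_eq_mul, mul_one] at h
    rw [Nat.totient]
    linarith
  simp only [fibArg]
  rw [Finset.prod_mul_distrib, ← Complex.exp_sum, ← Finset.sum_mul, ← Finset.mul_sum,
    ← Complex.ofReal_sum, hsum, Finset.prod_const]
  have : (Real.pi * ((n.totient / 2 : ℝ) : ℂ) * Complex.I : ℂ) =
      n.totient * (Real.pi / 2 * Complex.I) := by push_cast; ring
  rw [this, Complex.exp_nat_mul, Complex.exp_pi_div_two_mul_I, ← Nat.totient, ← mul_pow,
    Complex.I_mul_I]

/-- In the product over k, the powers of -z disappear because the product of all -z is 1, and the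
factors 1 - ζ give Φₙ(1). -/
theorem prod_aeval_derivative_fibotomic {n : ℕ} (hn : 2 ≤ n) :
    (∏ k ∈ (Finset.range n).filter n.Coprime,
      aeval (fibRoot (k / n)) (fibotomic n).derivative) * eval 1 (cyclotomic n ℂ) =
    2 ^ n.totient * ∏ ζ ∈ primitiveRoots n ℂ, eval ζ (derivative (cyclotomic n ℂ)) := by
  have h := Finset.prod_congr rfl fun k hk => aeval_derivative_fibotomic (k := k) hn hk
  have hneg : ∏ k ∈ (Finset.range n).filter n.Coprime, -fibArg (k / n) = 1 := by
    rw [Finset.prod_neg, prod_fibArg hn, ← Nat.totient, ← mul_pow]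
    norm_num
  simp only [Finset.prod_mul_distrib, Finset.prod_pow, hneg, one_pow, one_mul, mul_one,
    Finset.prod_const] at h
  rw [prod_coprime_pow (by omega) fun ζ => 1 - ζ,
    prod_coprime_pow (by omega) fun ζ => eval ζ (derivative (cyclotomic n ℂ)),
    ← cyclotomic_eval_eq_prod (by omega)] at h
  exact h

/-! ### Discriminant of the cyclotomic field -/

open nonZeroDivisors in
theorem NumberField.discr_cyclotomic_eq_discr_powerBasis (n : ℕ) [NeZero n] (K : Type*)
    [Field K] [NumberField K] [IsCyclotomicExtension {n} ℚ K] :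
    (NumberField.discr K : ℚ) = Algebra.discr ℚ
      ((IsCyclotomicExtension.zeta_spec n ℚ K).powerBasis ℚ).basis := by
  have hζ := IsCyclotomicExtension.zeta_spec n ℚ K
  -- The powers of ζ form an integral basis; localizing it gives the rational power basis.
  let pB₁ := hζ.integralPowerBasis
  rw [← NumberField.discr_eq_discr _ pB₁.basis, ← eq_intCast (algebraMap ℤ ℚ),
    ← Algebra.discr_localizationLocalization ℤ ℤ⁰ K]
  have : pB₁.dim = (hζ.powerBasis ℚ).dim := by
    rw [← PowerBasis.finrank, ← PowerBasis.finrank]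
    exact NumberField.RingOfIntegers.rank _
  rw [← Algebra.discr_reindex _ _ (finCongr this)]
  congr 1
  ext i
  rw [Function.comp_apply, Module.Basis.localizationLocalization_apply,
    PowerBasis.coe_basis, PowerBasis.coe_basis, hζ.integralPowerBasis_gen,
    IsPrimitiveRoot.powerBasis_gen]
  simp only [map_pow]
  rfl

/-- The discriminant is, up to sign, the norm of Φₙ'(ζ), and the embeddings into ℂ correspond to the
primitive n-th roots of unity. -/
theorem NumberField.discr_cyclotomic_eq_prod_eval_derivative (n : ℕ) [NeZero n] (K : Type*)
    [Field K] [NumberField K] [IsCyclotomicExtension {n} ℚ K] :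
    (NumberField.discr K : ℂ) =
      (-1) ^ (n.totient * (n.totient - 1) / 2) *
        ∏ ζ ∈ primitiveRoots n ℂ, eval ζ (derivative (cyclotomic n ℂ)) := by
  have hζ := IsCyclotomicExtension.zeta_spec n ℚ K
  have hirr := cyclotomic.irreducible_rat (NeZero.pos n)
  have h := discr_cyclotomic_eq_discr_powerBasis n K
  rw [Algebra.discr_powerBasis_eq_norm, IsPrimitiveRoot.powerBasis_gen,
    ← hζ.minpoly_eq_cyclotomic_of_irreducible hirr, IsCyclotomicExtension.Rat.finrank n K] at h
  have h := congrArg (algebraMap ℚ ℂ) h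
  rw [map_mul, map_pow, map_neg, map_one, Algebra.norm_eq_prod_embeddings] at h
  rw [← Finset.prod_coe_sort (primitiveRoots n ℂ),
    ← (hζ.embeddingsEquivPrimitiveRoots ℂ hirr).prod_comp]
  simp only [IsPrimitiveRoot.embeddingsEquivPrimitiveRoots_apply_coe]
  refine (by simp : (NumberField.discr K : ℂ) = _).trans (h.trans ?_)
  congr 1
  refine Finset.prod_congr rfl fun σ _ => ?_
  rw [← aeval_algHom_apply, ← eval_map_algebraMap, ← derivative_map, map_cyclotomic]

/-! ### The discriminant formula -/

/-- Both polynomials have degree φ(n), so the signs in the two discriminants agree. -/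
theorem discr_fibotomic_mul_eval_one_cyclotomic {n : ℕ} (hn : 2 ≤ n) [NeZero n] (K : Type*)
    [Field K] [NumberField K] [IsCyclotomicExtension {n} ℚ K] :
    ((fibotomic n).discr : ℚ) * eval 1 (cyclotomic n ℚ) =
      2 ^ n.totient * NumberField.discr K := by
  apply (algebraMap ℚ ℂ).injective
  have h : algebraMap ℚ ℂ (eval 1 (cyclotomic n ℚ)) = eval 1 (cyclotomic n ℂ) := by
    rw [← map_cyclotomic n (algebraMap ℚ ℂ), ← map_one (algebraMap ℚ ℂ), eval_map_apply]
  rw [map_mul, map_mul, h]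
  simp only [map_intCast, map_pow, map_ofNat]
  rw [NumberField.discr_cyclotomic_eq_prod_eval_derivative n K, discr_fibotomic hn, mul_assoc,
    prod_aeval_derivative_fibotomic hn]
  ring

theorem discr_fibotomic_mul_prod {n : ℕ} (hn : 2 ≤ n) :
    ((fibotomic n).discr : ℚ) * eval 1 (cyclotomic n ℚ) *
      ∏ p ∈ n.primeFactors, (p : ℚ) ^ (n.totient / (p - 1)) =
      (-1) ^ (n.totient / 2) * (2 * (n : ℚ)) ^ n.totient := by
  have : NeZero n := ⟨by omega⟩
  have : @IsCyclotomicExtension {n} ℚ (CyclotomicField n ℚ) _ _ DivisionRing.toRatAlgebra := by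
    convert! CyclotomicField.isCyclotomicExtension n ℚ
  have h1 := discr_fibotomic_mul_eval_one_cyclotomic hn (CyclotomicField n ℚ)
  have h2 := IsCyclotomicExtension.Rat.discr n (CyclotomicField n ℚ)
  -- The field discriminant is stated with integer division, which is exact.
  have hdvd := Nat.prod_primeFactors_pow_totient_ediv_dvd (by omega : 0 < n)
  obtain ⟨c, hc⟩ := hdvd
  have hP : ∏ p ∈ n.primeFactors, p ^ (n.totient / (p - 1)) ≠ 0 :=
    Finset.prod_ne_zero_iff.2 fun p hp => pow_ne_zero _ (Nat.prime_of_mem_primeFactors hp).ne_zero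
  have h3 : (n ^ n.totient / ∏ p ∈ n.primeFactors, p ^ (n.totient / (p - 1)) : ℤ) = c := by
    rw [← Nat.cast_pow, hc, Nat.cast_mul]
    exact Int.mul_ediv_cancel_left _ (mod_cast hP)
  rw [h3] at h2
  have h4 : (n : ℚ) ^ n.totient =
      (∏ p ∈ n.primeFactors, (p : ℚ) ^ (n.totient / (p - 1))) * c := by exact_mod_cast hc
  rw [h1, h2, mul_pow, h4]
  push_cast
  ring

theorem corollary4p2 (n : ℕ) (hn : 2 ≤ n) :
    (∀ p α : ℕ, p.Prime → 1 ≤ α → n = p ^ α →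
      ((fibotomic n).discr : ℚ) =
        (-1) ^ (Nat.totient n / 2) * (2 * (n : ℚ)) ^ Nat.totient n /
          (p : ℚ) ^ (p ^ (α - 1) + 1)) ∧
    ((¬ ∃ p α : ℕ, p.Prime ∧ 1 ≤ α ∧ n = p ^ α) →
      ((fibotomic n).discr : ℚ) =
        (-1) ^ (Nat.totient n / 2) * (2 * (n : ℚ)) ^ Nat.totient n /
          ∏ p ∈ n.primeFactors, (p : ℚ) ^ (Nat.totient n / (p - 1))) := by
  have h := discr_fibotomic_mul_prod hn
  constructor
  · intro p α hp hα hnp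
    obtain ⟨a, rfl⟩ : ∃ a, α = a + 1 := ⟨α - 1, by omega⟩
    have : Fact p.Prime := ⟨hp⟩
    have hp0 : (p : ℚ) ≠ 0 := by exact_mod_cast hp.ne_zero
    -- Here φ(n)/(p - 1) = p^(α-1); the extra 1 in the exponent comes from Φₙ(1) = p.
    rw [eq_div_iff (pow_ne_zero _ hp0), ← h, hnp, eval_one_cyclotomic_prime_pow,
      Nat.primeFactors_prime_pow a.succ_ne_zero hp, Finset.prod_singleton,
      Nat.totient_prime_pow_succ hp, Nat.mul_div_cancel _ (by have := hp.two_le; omega),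
      Nat.add_sub_cancel, pow_succ]
    ring
  · intro hnp
    have h1 : eval 1 (cyclotomic n ℚ) = 1 := by
      refine eval_one_cyclotomic_not_prime_pow fun {p} hp k hk => ?_
      refine hnp ⟨p, k, hp, Nat.pos_of_ne_zero ?_, hk.symm⟩
      rintro rfl
      rw [pow_zero] at hk
      omega
    rw [eq_div_iff, ← h, h1, mul_one]
    exact Finset.prod_ne_zero_iff.2 fun p hp => pow_ne_zero _
      (by exact_mod_cast (Nat.prime_of_mem_primeFactors hp).ne_zero)
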